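/- Let $(W,S)$ be a finite Coxeter system with set of reflections $T=\bigcup_{w\in W} wSw^{-1}$. Let $\ell_T(w)$ be the smallest $k$ such that $w$ is a product of $k$ reflections, let $v\leq_T w$ mean $\ell_T(v)+\ell_T(v^{-1}w)=\ell_T(w)$ (the absolute order), and let $[1,u]_T=\{v\in W : 1\leq_T v\leq_T u\}$, ordered by $\leq_T$. A parabolic subgroup of $W$ is a subgroup of the form $w\langle I\rangle w^{-1}$ with $w\in W$ and $I\subseteq S$; the parabolic closure $P(w)$ of $w\in W$ is the smallest parabolic subgroup containing $w$, that is, the intersection of all parabolic subgroups containing $w$. A parabolic subgroup $Q$ of $W$ is called involutive if $Q=P(x)$ for some $x\in W$ with $x^2=1$. By an involution we mean an element $x$ with $x^2=1$ (so $x=1$ is allowed). Let $u\in W$ be an involution. Then $$[1,u]_T=\{v\in P(u) : v^2=1\}.$$ Moreover, let $\mathcal{IP}(u)$ be the set of involutive parabolic subgroups of $P(u)$, that is, of the involutive subgroups $Q$ that are parabolic in the Coxeter group $P(u)$ (if $P(u)=w\langle I\rangle w^{-1}$, with Coxeter generators $wIw^{-1}$, these are the subgroups $p\,w\langle J\rangle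 w^{-1}p^{-1}$ with $p\in P(u)$ and $J\subseteq I$). Then $\mathcal{IP}(u)$ is also the set of all involutive parabolic subgroups of $W$ contained in $P(u)$, and the map $v\mapsto P(v)$ is an isomorphism of posets from $[1,u]_T$ onto $\mathcal{IP}(u)$ ordered by inclusion. -/

import Mathlib

namespace CoxeterSystem

section AbsoluteOrder

/-- Lengths of the expressions of `w` as a product of reflections. -/
def reflectionWordLengths {B W : Type*} [Group W] {M : CoxeterMatrix B} (cs : CoxeterSystem M W)
    (w : W) : Set ℕ :=
  {k | ∃ l : List W, (∀ t ∈ l, cs.IsReflection t) ∧ l.prod = w ∧ l.length = k}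

/-- The reflection length of `w`: the smallest number of reflections with product `w`.
The infimum is over a nonempty set, see `reflectionWordLengths_nonempty`. -/
noncomputable def reflectionLength {B W : Type*} [Group W] {M : CoxeterMatrix B}
    (cs : CoxeterSystem M W) (w : W) : ℕ :=
  sInf (cs.reflectionWordLengths w)

/-- The absolute order on `W`. -/
def AbsLE {B W : Type*} [Group W] {M : CoxeterMatrix B} (cs : CoxeterSystem M W)
    (v w : W) : Prop :=
  cs.reflectionLength v + cs.reflectionLength (v⁻¹ * w) = cs.reflectionLength w

theorem reflectionWordLengths_nonempty {B W : Type*} [Group W] {M : CoxeterMatrix B}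
    (cs : CoxeterSystem M W) (w : W) : (cs.reflectionWordLengths w).Nonempty := by
  obtain ⟨ω, rfl⟩ := cs.wordProd_surjective w
  refine ⟨_, ω.map cs.simple, ?_, rfl, rfl⟩
  intro t ht
  obtain ⟨i, -, rfl⟩ := List.mem_map.mp ht
  exact cs.isReflection_simple i

theorem exists_reflectionWord {B W : Type*} [Group W] {M : CoxeterMatrix B}
    (cs : CoxeterSystem M W) (w : W) :
    ∃ l : List W, (∀ t ∈ l, cs.IsReflection t) ∧ l.prod = w ∧
      l.length = cs.reflectionLength w :=
  Nat.sInf_mem (cs.reflectionWordLengths_nonempty w)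

theorem reflectionLength_one {B W : Type*} [Group W] {M : CoxeterMatrix B}
    (cs : CoxeterSystem M W) : cs.reflectionLength 1 = 0 :=
  Nat.le_zero.mp (Nat.sInf_le ⟨[], by simp, by simp, rfl⟩)

theorem eq_one_of_reflectionLength_eq_zero {B W : Type*} [Group W] {M : CoxeterMatrix B}
    (cs : CoxeterSystem M W) {w : W} (h : cs.reflectionLength w = 0) : w = 1 := by
  obtain ⟨l, -, rfl, hl⟩ := cs.exists_reflectionWord w
  rw [h, List.length_eq_zero_iff] at hl
  simp [hl]

theorem reflectionLength_mul_le {B W : Type*} [Group W] {M : CoxeterMatrix B}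
    (cs : CoxeterSystem M W) (v w : W) :
    cs.reflectionLength (v * w) ≤ cs.reflectionLength v + cs.reflectionLength w := by
  obtain ⟨l, hl, hlp, hll⟩ := cs.exists_reflectionWord v
  obtain ⟨m, hm, hmp, hml⟩ := cs.exists_reflectionWord w
  refine Nat.sInf_le ⟨l ++ m, ?_, by simp [hlp, hmp], by simp [hll, hml]⟩
  intro t ht
  rcases List.mem_append.mp ht with h | h
  · exact hl t h
  · exact hm t h

theorem absLE_refl {B W : Type*} [Group W] {M : CoxeterMatrix B}
    (cs : CoxeterSystem M W) (w : W) : cs.AbsLE w w := by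
  simp [AbsLE, cs.reflectionLength_one]

theorem absLE_trans {B W : Type*} [Group W] {M : CoxeterMatrix B}
    (cs : CoxeterSystem M W) {x y z : W} (h₁ : cs.AbsLE x y) (h₂ : cs.AbsLE y z) :
    cs.AbsLE x z := by
  have h₃ := cs.reflectionLength_mul_le (x⁻¹ * y) (y⁻¹ * z)
  have h₄ := cs.reflectionLength_mul_le x (x⁻¹ * z)
  rw [show x⁻¹ * y * (y⁻¹ * z) = x⁻¹ * z by group] at h₃
  rw [show x * (x⁻¹ * z) = z by group] at h₄
  unfold AbsLE at *
  omega

theorem absLE_antisymm {B W : Type*} [Group W] {M : CoxeterMatrix B}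
    (cs : CoxeterSystem M W) {x y : W} (h₁ : cs.AbsLE x y) (h₂ : cs.AbsLE y x) : x = y := by
  unfold AbsLE at *
  exact inv_mul_eq_one.mp (cs.eq_one_of_reflectionLength_eq_zero (w := x⁻¹ * y) (by omega))

/-- The interval `[1,u]` for the absolute order, as a subset of `W`. -/
def absInterval {B W : Type*} [Group W] {M : CoxeterMatrix B} (cs : CoxeterSystem M W)
    (u : W) : Set W :=
  {v | cs.AbsLE 1 v ∧ cs.AbsLE v u}

/-- The interval `[1,u]` for the absolute order, as a poset ordered by the absolute order. -/
def AbsInterval {B W : Type*} [Group W] {M : CoxeterMatrix B} (cs : CoxeterSystem M W)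
    (u : W) : Type _ :=
  {v : W // v ∈ cs.absInterval u}

instance instPartialOrderAbsInterval {B W : Type*} [Group W] {M : CoxeterMatrix B}
    (cs : CoxeterSystem M W) (u : W) : PartialOrder (cs.AbsInterval u) where
  le v w := cs.AbsLE v.1 w.1
  le_refl v := cs.absLE_refl v.1
  le_trans _ _ _ h₁ h₂ := cs.absLE_trans h₁ h₂
  le_antisymm _ _ h₁ h₂ := Subtype.ext (cs.absLE_antisymm h₁ h₂)

end AbsoluteOrder

section Parabolic

/-- The standard parabolic subgroup generated by the simple reflections indexed by `I`. -/
def standardParabolic {B W : Type*} [Group W] {M : CoxeterMatrix B} (cs : CoxeterSystem M W)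
    (I : Set B) : Subgroup W :=
  Subgroup.closure (cs.simple '' I)

/-- The conjugate `w W_I w⁻¹` of the standard parabolic subgroup `W_I`. -/
def conjParabolic {B W : Type*} [Group W] {M : CoxeterMatrix B} (cs : CoxeterSystem M W)
    (w : W) (I : Set B) : Subgroup W :=
  (cs.standardParabolic I).map (MulAut.conj w).toMonoidHom

/-- Parabolic subgroups of `W`. -/
def IsParabolic {B W : Type*} [Group W] {M : CoxeterMatrix B} (cs : CoxeterSystem M W)
    (P : Subgroup W) : Prop :=
  ∃ (w : W) (I : Set B), P = cs.conjParabolic w I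

/-- The parabolic closure of `w`: the intersection of all parabolic subgroups containing `w`. -/
def parabolicClosure {B W : Type*} [Group W] {M : CoxeterMatrix B} (cs : CoxeterSystem M W)
    (w : W) : Subgroup W :=
  sInf {P | cs.IsParabolic P ∧ w ∈ P}

/-- `P` is parabolic, and it is the parabolic closure of an `x` with `x² = 1`. -/
def IsInvolutiveParabolic {B W : Type*} [Group W] {M : CoxeterMatrix B}
    (cs : CoxeterSystem M W) (P : Subgroup W) : Prop :=
  cs.IsParabolic P ∧ ∃ x : W, x ^ 2 = 1 ∧ cs.parabolicClosure x = P

/-- `Q` is a parabolic subgroup of the Coxeter group `P`, where `P = w W_I w⁻¹` is a parabolic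
subgroup of `W` with Coxeter generators `w s w⁻¹`, `s ∈ I`: for some `p ∈ P` and `J ⊆ I`, `Q` is
the conjugate by `p` of the subgroup `w W_J w⁻¹` that is generated by the `w s w⁻¹`, `s ∈ J`. -/
def IsParabolicIn {B W : Type*} [Group W] {M : CoxeterMatrix B} (cs : CoxeterSystem M W)
    (P Q : Subgroup W) : Prop :=
  ∃ (w : W) (I : Set B), P = cs.conjParabolic w I ∧
    ∃ p ∈ P, ∃ J ⊆ I, Q = cs.conjParabolic (p * w) J

/-- The involutive parabolic subgroups of the Coxeter group `P(u)`. -/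
def involutiveParabolicsOf {B W : Type*} [Group W] {M : CoxeterMatrix B}
    (cs : CoxeterSystem M W) (u : W) : Set (Subgroup W) :=
  {Q | cs.IsParabolicIn (cs.parabolicClosure u) Q ∧ cs.IsInvolutiveParabolic Q}

end Parabolic

end CoxeterSystem

/-! The group acts on `B →₀ ℝ` by the geometric representation. For finite `W`, averaging gives an
invariant inner product, so `Mov w = im (w - 1)` is the orthogonal complement of `Fix w`.

Parabolic subgroups are exactly the stabilizers of points. Hence `P(w)` is the pointwise stabilizer
of `Fix w`, and `v ∈ P(w)` iff `Mov v ⊆ Mov w` (`mem_parabolicClosure_iff_movedSpace_le`). Carter's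
formula `ℓ_T(w) = dim Mov w` (`reflectionLength_eq_finrank_movedSpace`) then turns `v ≤_T u` into
the statement that `Mov u` is the direct sum of `Mov v` and `Mov (v⁻¹u)`.

An involution `u` acts as `-1` on `Mov u`. This makes the sum direct when `v ∈ P(u)` and `v² = 1`,
and conversely forces `v² = 1` when `v ≤_T u` (`absLE_iff_of_sq_eq_one`). Every element of the
interval is thus an involution, so the criterion applies to any two of them and gives the poset
isomorphism. -/

open Polynomial Real

/-! ### Simple reflections and the Coxeter relations -/

namespace CoxeterMatrix

variable {B : Type*} (M : CoxeterMatrix B)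

/-- The linear form `x ↦ 2⟨α i, x⟩` for the standard bilinear form on `B →₀ ℝ`. -/
noncomputable def geomCoroot (i : B) : Module.Dual ℝ (B →₀ ℝ) :=
  Finsupp.linearCombination ℝ fun j => -2 * cos (π / M i j)

theorem geomCoroot_single (i j : B) :
    M.geomCoroot i (Finsupp.single j 1) = -2 * cos (π / M i j) := by
  simp [geomCoroot]

theorem geomCoroot_self (i : B) : M.geomCoroot i (Finsupp.single i 1) = 2 := by
  simp [geomCoroot_single]

theorem geomCoroot_comm (i j : B) :
    M.geomCoroot i (Finsupp.single j 1) = M.geomCoroot j (Finsupp.single i 1) := by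
  rw [geomCoroot_single, geomCoroot_single, M.symmetric]

/-- The reflection of the geometric representation attached to `i`. -/
noncomputable def geomReflection (i : B) : (B →₀ ℝ) ≃ₗ[ℝ] (B →₀ ℝ) :=
  Module.reflection (M.geomCoroot_self i)

theorem geomReflection_apply (i : B) (x : B →₀ ℝ) :
    M.geomReflection i x = x - M.geomCoroot i x • Finsupp.single i 1 :=
  Module.reflection_apply ..

theorem eval_chebyshevS_mul_sin (k : ℤ) (φ : ℝ) :
    (Chebyshev.S ℝ k).eval (2 * cos φ) * sin φ = sin ((k + 1) * φ) := by
  rw [← Chebyshev.U_real_cos, ← Chebyshev.S_comp_two_mul_X]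
  simp

theorem eval_chebyshevS_of_even {q : ℕ} (hq : 2 ≤ q) :
    (Chebyshev.S ℝ (q - 1)).eval (2 * cos (2 * (π / (2 * q : ℕ)))) = 0 := by
  have hq' : (2 : ℝ) ≤ q := by exact_mod_cast hq
  have hφ : 2 * (π / (2 * q : ℕ)) = π / q := by push_cast; field_simp
  have hsin : sin (π / q) ≠ 0 :=
    (sin_pos_of_pos_of_lt_pi (by positivity) (div_lt_self pi_pos (by linarith))).ne'
  have h := eval_chebyshevS_mul_sin (q - 1) (π / q)
  push_cast at h
  rw [sub_add_cancel, mul_div_cancel₀ _ (by positivity), sin_pi] at h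
  rw [hφ]
  exact (mul_eq_zero.mp h).resolve_right hsin

theorem eval_chebyshevS_add_of_odd {q : ℕ} (hq : 1 ≤ q) :
    (Chebyshev.S ℝ q).eval (2 * cos (2 * (π / (2 * q + 1 : ℕ)))) +
      (Chebyshev.S ℝ (q - 1)).eval (2 * cos (2 * (π / (2 * q + 1 : ℕ)))) = 0 := by
  have hq' : (1 : ℝ) ≤ q := by exact_mod_cast hq
  set φ : ℝ := 2 * (π / (2 * q + 1 : ℕ)) with hφ
  have hsin : sin φ ≠ 0 := by
    refine (sin_pos_of_pos_of_lt_pi (by positivity) ?_).ne'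
    rw [hφ, ← mul_div_assoc, div_lt_iff₀ (by positivity)]
    push_cast
    nlinarith [pi_pos]
  have h₁ := eval_chebyshevS_mul_sin q φ
  have h₂ := eval_chebyshevS_mul_sin (q - 1) φ
  have h₃ : ((q : ℤ) + 1 : ℝ) * φ = 2 * π - (q : ℤ) * φ := by
    rw [hφ]; push_cast; field_simp; ring
  push_cast at h₁ h₂ h₃
  rw [h₃, sin_two_pi_sub] at h₁
  rw [sub_add_cancel] at h₂
  refine (mul_eq_zero.mp (?_ : _ * sin φ = 0)).resolve_right hsin
  rw [add_mul, h₁, h₂, neg_add_cancel]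

/-- Powers of a product of two reflections have Chebyshev coefficients evaluated at `4cos²(π/m) - 2
= 2cos(2π/m)`. They cancel because `S_{q-1}` vanishes there for `m = 2q`, and `S_q + S_{q-1}` does
for `m = 2q + 1`. For `m = 2` there is no such vanishing; the two roots are orthogonal instead. -/
theorem geomReflection_mul_pow (i j : B) :
    (M.geomReflection i * M.geomReflection j) ^ M i j = 1 := by
  rcases eq_or_ne i j with rfl | hij
  · rw [M.diagonal, pow_one]
    ext1 x
    exact Module.involutive_reflection (M.geomCoroot_self i) x
  rcases Nat.eq_zero_or_pos (M i j) with h0 | hpos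
  · simp [h0]
  have h1 : M i j ≠ 1 := M.off_diagonal i j hij
  refine LinearEquiv.ext fun x => ?_
  have key := Module.reflection_mul_reflection_pow_apply (M.geomCoroot_self i)
    (M.geomCoroot_self j) (M i j) x (2 * cos (2 * (π / M i j))) (by
      rw [M.geomCoroot_comm j i, geomCoroot_single, cos_two_mul]; ring)
  refine key.trans ?_
  rw [LinearEquiv.coe_one, id]
  rcases eq_or_ne (M i j) 2 with h2 | h2
  · have hc : M.geomCoroot i (Finsupp.single j 1) = 0 := by
      rw [geomCoroot_single, h2]; simp
    have hcos : cos (2 * (π / (2 : ℕ))) = -1 := by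
      rw [Nat.cast_ofNat, mul_div_cancel₀ _ two_ne_zero, cos_pi]
    rw [M.geomCoroot_comm j i, hc, h2, hcos]
    norm_num
    module
  obtain ⟨q, hq | hq⟩ : ∃ q, M i j = 2 * q ∨ M i j = 2 * q + 1 := ⟨M i j / 2, by omega⟩
  · rw [hq]
    have e₁ : (((2 * q : ℕ) : ℤ) - 2) / 2 = q - 1 := by omega
    have e₂ : (((2 * q : ℕ) : ℤ) - 1) / 2 = q - 1 := by omega
    rw [e₁, e₂, eval_chebyshevS_of_even (by omega)]
    simp
  · rw [hq]
    have e₁ : (((2 * q + 1 : ℕ) : ℤ) - 1) / 2 = q := by omega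
    have e₂ : (((2 * q + 1 : ℕ) : ℤ) - 2) / 2 = q - 1 := by omega
    have e₃ : (((2 * q + 1 : ℕ) : ℤ) - 3) / 2 = q - 1 := by omega
    have e₄ : ((2 * q + 1 : ℕ) : ℤ) / 2 = q := by omega
    rw [e₁, e₂, e₃, e₄, eval_chebyshevS_add_of_odd (by omega)]
    simp

end CoxeterMatrix

/-! ### The geometric representation: signs of roots and faithfulness -/

namespace CoxeterSystem

variable {B W : Type*} [Group W] {M : CoxeterMatrix B} (cs : CoxeterSystem M W)

theorem isLiftable_geomReflection :
    M.IsLiftable fun i => (M.geomReflection i : Module.End ℝ (B →₀ ℝ)) := fun i j => by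
  have h := congrArg (LinearEquiv.automorphismGroup.toLinearMapMonoidHom (R := ℝ) (M := B →₀ ℝ))
    (M.geomReflection_mul_pow i j)
  rw [map_pow, map_mul, map_one] at h
  exact h

/-- The geometric representation of a Coxeter group. -/
noncomputable def geomRep : W →* Module.End ℝ (B →₀ ℝ) :=
  cs.lift ⟨_, isLiftable_geomReflection⟩

theorem geomRep_simple_apply (i : B) (x : B →₀ ℝ) :
    cs.geomRep (cs.simple i) x = x - M.geomCoroot i x • Finsupp.single i 1 := by
  rw [geomRep, lift_apply_simple, LinearEquiv.coe_coe, CoxeterMatrix.geomReflection_apply]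

theorem geomRep_simple_single (i : B) :
    cs.geomRep (cs.simple i) (Finsupp.single i 1) = -Finsupp.single i 1 := by
  rw [geomRep_simple_apply, M.geomCoroot_self]
  module

theorem geomRep_mul_apply (v w : W) (x : B →₀ ℝ) :
    cs.geomRep (v * w) x = cs.geomRep v (cs.geomRep w x) := by
  rw [map_mul, Module.End.mul_apply]

theorem geomRep_alternatingWord (i j : B) (k : ℕ) :
    cs.geomRep (cs.wordProd (alternatingWord i j k)) (Finsupp.single i 1) =
      (Chebyshev.U ℝ k).eval (cos (π / M i j)) •
        Finsupp.single (if Even k then i else j) 1 +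
      (Chebyshev.U ℝ (k - 1)).eval (cos (π / M i j)) •
        Finsupp.single (if Even k then j else i) 1 := by
  induction k with
  | zero => simp [alternatingWord]
  | succ k ih =>
    have hU : (Chebyshev.U ℝ (k + 1 : ℤ)).eval (cos (π / M i j)) =
        2 * cos (π / M i j) * (Chebyshev.U ℝ k).eval (cos (π / M i j)) -
          (Chebyshev.U ℝ (k - 1)).eval (cos (π / M i j)) := by
      rw [Chebyshev.U_add_one]; simp
    rw [alternatingWord_succ', wordProd_cons, geomRep_mul_apply, ih]
    push_cast
    rw [add_sub_cancel_right, hU]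
    by_cases hk : Even k
    · simp only [hk, if_true, Nat.even_add_one, not_true_eq_false, if_false, geomRep_simple_apply,
        map_add, map_smul, M.geomCoroot_self, M.geomCoroot_single, M.symmetric j i]
      module
    · simp only [hk, Nat.even_add_one, not_false_eq_true, if_true, if_false, geomRep_simple_apply,
        map_add, map_smul, M.geomCoroot_self, M.geomCoroot_single]
      module

theorem eval_chebyshevU_nonneg {m k : ℕ} (hm : m ≠ 1) (hk : m = 0 ∨ k ≤ m) :
    0 ≤ (Chebyshev.U ℝ (k - 1)).eval (cos (π / m)) := by
  -- For `m = 0` (infinite order) `π / 0 = 0`, so the value is `U_{k-1}(1) = k`.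
  rcases Nat.eq_zero_or_pos m with rfl | hpos
  · simp
  have hk' : (k : ℝ) ≤ m := by exact_mod_cast hk.resolve_left hpos.ne'
  have hm' : (2 : ℝ) ≤ m := by exact_mod_cast (show 2 ≤ m by omega)
  have hsin : 0 < sin (π / m) :=
    sin_pos_of_pos_of_lt_pi (by positivity) (div_lt_self pi_pos (by linarith))
  have h := Chebyshev.U_real_cos (π / m) (k - 1)
  push_cast at h
  rw [sub_add_cancel] at h
  refine nonneg_of_mul_nonneg_left (h.symm ▸ sin_nonneg_of_nonneg_of_le_pi (by positivity) ?_) hsin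
  rw [← mul_div_assoc, div_le_iff₀ (by positivity), mul_comm]
  gcongr

/-- Every `w` factors as `v * a`, with lengths adding, where `a` is alternating in `i` and `j` with
last letter `j`, and `v` has neither `i` nor `j` as a right descent. -/
theorem exists_eq_mul_alternatingWord {w : W} {i j : B} (hi : ¬cs.IsRightDescent w i) :
    ∃ (v : W) (k : ℕ), w = v * cs.wordProd (alternatingWord i j k) ∧
      cs.length w = cs.length v + k ∧ ¬cs.IsRightDescent v i ∧ ¬cs.IsRightDescent v j := by
  classical
  -- Take `k` maximal. A descent of `v` at the next letter would extend the alternating word; a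
  -- descent at the other letter would cancel its first letter and make `w` too short, or contradict
  -- `hi` if `k = 0`.
  let p : ℕ → Prop := fun k =>
    ∃ v : W, w = v * cs.wordProd (alternatingWord i j k) ∧ cs.length w = cs.length v + k
  have hp0 : p 0 := ⟨w, by simp [alternatingWord], by simp⟩
  obtain ⟨v, hv, hl⟩ := Nat.findGreatest_spec (P := p) (Nat.zero_le (cs.length w)) hp0
  set k := Nat.findGreatest p (cs.length w) with hk
  have hnext : ¬cs.IsRightDescent v (if Even k then j else i) := by
    intro h
    rw [isRightDescent_iff] at h
    have : p (k + 1) := by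
      refine ⟨v * cs.simple (if Even k then j else i), ?_, by omega⟩
      rw [alternatingWord_succ', wordProd_cons, ← mul_assoc, simple_mul_simple_cancel_right]
      exact hv
    have := Nat.le_findGreatest (P := p) (n := cs.length w) (by omega) this
    omega
  have hprev : ¬cs.IsRightDescent v (if Even k then i else j) := by
    intro h
    rcases Nat.eq_zero_or_pos k with h0 | hpos
    · rw [h0] at h hv
      simp only [alternatingWord, wordProd_nil, mul_one] at hv
      subst hv
      simp at h
      exact hi h
    obtain ⟨l, hkl⟩ : ∃ l, k = l + 1 := ⟨k - 1, by omega⟩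
    rw [isRightDescent_iff] at h
    rw [hkl] at h hv
    rw [alternatingWord_succ', wordProd_cons, ← mul_assoc] at hv
    have h₁ := cs.length_mul_le (v * cs.simple (if Even l then j else i))
      (cs.wordProd (alternatingWord i j l))
    have h₂ := cs.length_wordProd_le (alternatingWord i j l)
    rw [length_alternatingWord] at h₂
    rw [← hv] at h₁
    have : (if Even (l + 1) then i else j) = if Even l then j else i := by
      by_cases hl : Even l <;> simp [hl, Nat.even_add_one]
    rw [this] at h
    omega
  refine ⟨v, k, hv, hl, ?_⟩
  by_cases hk : Even k
  · simp only [hk, if_true] at hnext hprev; exact ⟨hprev, hnext⟩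
  · simp only [hk, if_false] at hnext hprev; exact ⟨hnext, hprev⟩

/-- Induction on length: the alternating right factor of `w` sends the simple root `i` to a
nonnegative combination of the simple roots `i` and `j`, and the shorter left factor keeps both
nonnegative. -/
theorem geomRep_single_nonneg {w : W} {i : B} (h : ¬cs.IsRightDescent w i) :
    0 ≤ cs.geomRep w (Finsupp.single i 1) := by
  induction hn : cs.length w using Nat.strong_induction_on generalizing w i with
  | _ n ih =>
  rcases eq_or_ne w 1 with rfl | hw
  · simp
  obtain ⟨j, hj⟩ := cs.exists_rightDescent_of_ne_one hw
  have hij : i ≠ j := by rintro rfl; exact h hj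
  obtain ⟨v, k, hv, hl, hvi, hvj⟩ := cs.exists_eq_mul_alternatingWord (j := j) h
  have hk : 0 < k := by
    rcases Nat.eq_zero_or_pos k with rfl | hk
    · simp only [alternatingWord, wordProd_nil, mul_one] at hv
      exact absurd (hv ▸ hj) hvj
    · exact hk
  -- Otherwise `w * s_i`, of length `ℓ(v) + k + 1`, would be `v` times a non-reduced alternating
  -- word of `k + 1` letters.
  have hkm : M i j = 0 ∨ k + 1 ≤ M i j := by
    by_contra! hc
    have hred := cs.not_isReduced_alternatingWord j i (m := k + 1)
      (M.symmetric i j ▸ hc.1) (M.symmetric i j ▸ hc.2)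
    have h₁ := cs.length_wordProd_le (alternatingWord j i (k + 1))
    rw [IsReduced] at hred
    rw [length_alternatingWord] at h₁ hred
    have h₂ : w * cs.simple i = v * cs.wordProd (alternatingWord j i (k + 1)) := by
      rw [alternatingWord_succ, wordProd_concat, ← mul_assoc, ← hv]
    have h₃ := cs.length_mul_le v (cs.wordProd (alternatingWord j i (k + 1)))
    rw [← h₂, cs.not_isRightDescent_iff.mp h] at h₃
    omega
  have hm := M.off_diagonal i j hij
  have h₁ := eval_chebyshevU_nonneg (k := k + 1) hm hkm
  have h₂ := eval_chebyshevU_nonneg (k := k) hm (by omega)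
  push_cast at h₁
  rw [add_sub_cancel_right] at h₁
  rw [hv, geomRep_mul_apply, geomRep_alternatingWord, map_add, map_smul, map_smul]
  have hvpos : ∀ b, b = i ∨ b = j → 0 ≤ cs.geomRep v (Finsupp.single b 1) := by
    rintro b (rfl | rfl)
    · exact ih _ (by omega) hvi rfl
    · exact ih _ (by omega) hvj rfl
  refine add_nonneg (smul_nonneg h₁ (hvpos _ ?_)) (smul_nonneg h₂ (hvpos _ ?_)) <;>
    split_ifs <;> simp

theorem geomRep_single_nonpos {w : W} {i : B} (h : cs.IsRightDescent w i) :
    cs.geomRep w (Finsupp.single i 1) ≤ 0 := by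
  have := cs.geomRep_single_nonneg (cs.isRightDescent_iff_not_isRightDescent_mul.mp h)
  rw [geomRep_mul_apply, geomRep_simple_single, map_neg] at this
  exact neg_nonneg.mp this

theorem eq_one_of_geomRep_eq_one {w : W} (h : cs.geomRep w = 1) : w = 1 := by
  by_contra hw
  obtain ⟨i, hi⟩ := cs.exists_rightDescent_of_ne_one hw
  have := cs.geomRep_single_nonpos hi i
  rw [h, Module.End.one_apply] at this
  norm_num at this

theorem simple_injective : Function.Injective cs.simple := by
  intro i j h
  by_contra hij
  have h₁ := cs.geomRep_simple_single i
  rw [h, geomRep_simple_apply] at h₁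
  have := DFunLike.congr_fun h₁ i
  simp [Ne.symm hij] at this
  norm_num at this

end CoxeterSystem

namespace CoxeterSystem

variable {B W : Type*} [Group W] {M : CoxeterMatrix B} (cs : CoxeterSystem M W)

theorem finite_index (cs : CoxeterSystem M W) [Finite W] : Finite B :=
  Finite.of_injective _ cs.simple_injective

theorem geomRep_inv_apply_apply (w : W) (x : B →₀ ℝ) :
    cs.geomRep w⁻¹ (cs.geomRep w x) = x := by
  rw [← geomRep_mul_apply, inv_mul_cancel, map_one, Module.End.one_apply]

theorem geomRep_apply_inv_apply (w : W) (x : B →₀ ℝ) :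
    cs.geomRep w (cs.geomRep w⁻¹ x) = x := by
  rw [← geomRep_mul_apply, mul_inv_cancel, map_one, Module.End.one_apply]

/-! ### An invariant inner product -/

/-- The coordinate dot product is summed over its translates by `W`; positivity of the cosine form
is not needed. -/
theorem exists_invariant_form [Finite W] :
    ∃ q : LinearMap.BilinForm ℝ (B →₀ ℝ), (∀ x y, q x y = q y x) ∧ (∀ x, x ≠ 0 → 0 < q x x) ∧
      ∀ w x y, q (cs.geomRep w x) (cs.geomRep w y) = q x y := by
  have := cs.finite_index
  cases nonempty_fintype B
  cases nonempty_fintype W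
  let l (w : W) (b : B) : Module.Dual ℝ (B →₀ ℝ) := Finsupp.lapply b ∘ₗ cs.geomRep w
  have hq : ∀ x y, (∑ w, ∑ b, LinearMap.BilinForm.linMulLin (l w b) (l w b)) x y =
      ∑ w, ∑ b, cs.geomRep w x b * cs.geomRep w y b := by
    intro x y
    simp [l, LinearMap.sum_apply]
  refine ⟨∑ w, ∑ b, LinearMap.BilinForm.linMulLin (l w b) (l w b), fun x y => ?_, fun x hx => ?_,
    fun w x y => ?_⟩
  · simp only [hq, mul_comm]
  · rw [hq]
    obtain ⟨b, hb⟩ := DFunLike.ne_iff.mp hx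
    refine Finset.sum_pos' (fun w _ => Finset.sum_nonneg fun b _ => mul_self_nonneg _)
      ⟨1, Finset.mem_univ _, ?_⟩
    refine Finset.sum_pos' (fun b _ => mul_self_nonneg _) ⟨b, Finset.mem_univ _, ?_⟩
    rw [map_one, Module.End.one_apply]
    exact mul_self_pos.mpr hb
  · rw [hq, hq]
    simp only [← geomRep_mul_apply]
    exact Equiv.sum_comp (Equiv.mulRight w) fun v => ∑ b, cs.geomRep v x b * cs.geomRep v y b

/-- A positive definite bilinear form invariant under the geometric representation. -/
noncomputable def invForm [Finite W] : LinearMap.BilinForm ℝ (B →₀ ℝ) :=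
  cs.exists_invariant_form.choose

section

variable [Finite W]

theorem invForm_comm (x y : B →₀ ℝ) : cs.invForm x y = cs.invForm y x :=
  cs.exists_invariant_form.choose_spec.1 x y

theorem invForm_self_pos {x : B →₀ ℝ} (hx : x ≠ 0) : 0 < cs.invForm x x :=
  cs.exists_invariant_form.choose_spec.2.1 x hx

theorem eq_zero_of_invForm_self {x : B →₀ ℝ} (hx : cs.invForm x x = 0) : x = 0 := by
  by_contra h
  exact (cs.invForm_self_pos h).ne' hx

theorem invForm_geomRep (w : W) (x y : B →₀ ℝ) :
    cs.invForm (cs.geomRep w x) (cs.geomRep w y) = cs.invForm x y :=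
  cs.exists_invariant_form.choose_spec.2.2 w x y

theorem invForm_isRefl : cs.invForm.IsRefl := fun x y h => by rw [invForm_comm, h]

theorem invForm_nondegenerate : cs.invForm.Nondegenerate :=
  ⟨fun x h => cs.eq_zero_of_invForm_self (h x), fun x h => cs.eq_zero_of_invForm_self (h x)⟩

/-- Invariance under `s_i`, which negates the simple root, ties the averaged form to the coroot, so
both define the same dominant chamber. -/
theorem two_mul_invForm_single (i : B) (x : B →₀ ℝ) :
    2 * cs.invForm x (Finsupp.single i 1) =
      M.geomCoroot i x * cs.invForm (Finsupp.single i 1) (Finsupp.single i 1) := by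
  have h := cs.invForm_geomRep (cs.simple i) x (Finsupp.single i 1)
  rw [geomRep_simple_single, geomRep_simple_apply] at h
  simp only [map_sub, map_neg, map_smul, LinearMap.sub_apply, LinearMap.smul_apply,
    smul_eq_mul] at h
  linarith

theorem invForm_single_self_pos (i : B) :
    0 < cs.invForm (Finsupp.single i 1) (Finsupp.single i 1) :=
  cs.invForm_self_pos (by simp)

theorem geomRep_simple_apply_eq_self_iff (i : B) (x : B →₀ ℝ) :
    cs.geomRep (cs.simple i) x = x ↔ cs.invForm x (Finsupp.single i 1) = 0 := by
  have h := cs.two_mul_invForm_single i x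
  have hpos := cs.invForm_single_self_pos i
  rw [geomRep_simple_apply, sub_eq_self, smul_eq_zero, or_iff_left (by simp)]
  constructor <;> intro h0
  · rw [h0] at h; linarith
  · rw [h0, mul_zero] at h
    exact (mul_eq_zero.mp h.symm).resolve_right hpos.ne'

theorem invForm_eq_sum (x y : B →₀ ℝ) :
    cs.invForm x y = y.sum fun b c => c * cs.invForm x (Finsupp.single b 1) := by
  conv_lhs => rw [← y.sum_single]
  rw [map_finsuppSum]
  refine Finsupp.sum_congr fun b _ => ?_
  rw [← smul_eq_mul, ← map_smul, Finsupp.smul_single_one]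

theorem exists_invForm_single_eq (c : B → ℝ) :
    ∃ y, ∀ b, cs.invForm y (Finsupp.single b 1) = c b := by
  have := cs.finite_index
  cases nonempty_fintype B
  let Φ : (B →₀ ℝ) →ₗ[ℝ] (B → ℝ) :=
    LinearMap.pi fun b => LinearMap.flip cs.invForm (Finsupp.single b 1)
  have hinj : Function.Injective Φ := by
    rw [injective_iff_map_eq_zero]
    intro y hy
    refine cs.eq_zero_of_invForm_self ?_
    rw [invForm_eq_sum]
    refine Finset.sum_eq_zero fun b _ => ?_
    exact mul_eq_zero_of_right _ (congrFun hy b)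
  obtain ⟨y, hy⟩ := (LinearMap.injective_iff_surjective_of_finrank_eq_finrank
    (by simp)).mp hinj c
  exact ⟨y, congrFun hy⟩

end

/-! ### Stabilizers are parabolic -/

theorem simple_mem_standardParabolic {I : Set B} {i : B} (hi : i ∈ I) :
    cs.simple i ∈ cs.standardParabolic I :=
  Subgroup.subset_closure ⟨i, hi, rfl⟩

theorem standardParabolic_univ : cs.standardParabolic Set.univ = ⊤ := by
  rw [standardParabolic, Set.image_univ, subgroup_closure_range_simple]

theorem standardParabolic_mono {I J : Set B} (h : I ⊆ J) :
    cs.standardParabolic I ≤ cs.standardParabolic J :=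
  Subgroup.closure_mono (Set.image_mono h)

theorem mem_conjParabolic {g w : W} {I : Set B} :
    w ∈ cs.conjParabolic g I ↔ g⁻¹ * w * g ∈ cs.standardParabolic I := by
  rw [conjParabolic, Subgroup.mem_map]
  constructor
  · rintro ⟨v, hv, rfl⟩
    simpa [mul_assoc] using hv
  · intro h
    exact ⟨_, h, by simp [mul_assoc]⟩

theorem geomRep_apply_of_mem_standardParabolic {I : Set B} {w : W}
    (hw : w ∈ cs.standardParabolic I) (x : B →₀ ℝ) {b : B} (hb : b ∉ I) :
    cs.geomRep w x b = x b := by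
  induction hw using Subgroup.closure_induction generalizing x with
  | mem _ h =>
    obtain ⟨i, hi, rfl⟩ := h
    have : i ≠ b := by rintro rfl; exact hb hi
    simp [geomRep_simple_apply, this]
  | one => simp
  | mul v w _ _ hv hw => rw [geomRep_mul_apply, hv, hw]
  | inv v _ hv => rw [← hv, geomRep_apply_inv_apply]

theorem mem_of_isRightDescent_of_mem_standardParabolic {I : Set B} {w : W} {i : B}
    (hw : w ∈ cs.standardParabolic I) (h : cs.IsRightDescent w i) : i ∈ I := by
  by_contra hi
  have h₁ := cs.geomRep_single_nonpos h i
  rw [cs.geomRep_apply_of_mem_standardParabolic hw _ hi] at h₁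
  norm_num at h₁

/-- Every point can be moved into the dominant chamber of a standard parabolic subgroup. -/
theorem exists_geomCoroot_nonneg [Finite W] (I : Set B) (x : B →₀ ℝ) :
    ∃ p ∈ cs.standardParabolic I, ∀ i ∈ I, 0 ≤ M.geomCoroot i (cs.geomRep p x) := by
  -- The coordinate sum `h` drops by the `i`-th coroot value under `s_i`, so a point of the orbit
  -- maximizing `h` is dominant.
  let h : Module.Dual ℝ (B →₀ ℝ) := Finsupp.linearCombination ℝ fun _ => 1
  obtain ⟨⟨p, hp⟩, hmax⟩ :=
    Finite.exists_max fun p : cs.standardParabolic I => h (cs.geomRep p x)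
  refine ⟨p, hp, fun i hi => ?_⟩
  have := hmax ⟨_, mul_mem (cs.simple_mem_standardParabolic hi) hp⟩
  simp only [geomRep_mul_apply, geomRep_simple_apply, map_sub, map_smul] at this
  have h1 : h (Finsupp.single i 1) = 1 := by simp [h]
  rw [h1, smul_eq_mul, mul_one] at this
  linarith

/-- At a right descent `i` the root `w α_i` is nonpositive and supported on `I`, so `⟨y, α_i⟩ = ⟨y,
w α_i⟩ ≤ 0`. Dominance makes this zero: `s_i` fixes `y`, and induction applies to `w s_i`. -/
theorem mem_standardParabolic_of_geomRep_eq_self [Finite W] {I : Set B} {y : B →₀ ℝ}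
    (hy : ∀ i ∈ I, 0 ≤ cs.invForm y (Finsupp.single i 1)) {w : W}
    (hw : w ∈ cs.standardParabolic I) (hwy : cs.geomRep w y = y) :
    w ∈ cs.standardParabolic {i ∈ I | cs.geomRep (cs.simple i) y = y} := by
  induction hn : cs.length w using Nat.strong_induction_on generalizing w with
  | _ n ih =>
  rcases eq_or_ne w 1 with rfl | hw1
  · exact one_mem _
  obtain ⟨i, hi⟩ := cs.exists_rightDescent_of_ne_one hw1
  have hiI := cs.mem_of_isRightDescent_of_mem_standardParabolic hw hi
  have hle : cs.invForm y (Finsupp.single i 1) ≤ 0 := by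
    rw [← cs.invForm_geomRep w, hwy, invForm_eq_sum]
    refine Finset.sum_nonpos fun b _ => ?_
    by_cases hb : b ∈ I
    · exact mul_nonpos_of_nonpos_of_nonneg (cs.geomRep_single_nonpos hi b) (hy b hb)
    · rw [cs.geomRep_apply_of_mem_standardParabolic hw _ hb,
        Finsupp.single_eq_of_ne (by rintro rfl; exact hb hiI)]
      exact (zero_mul _).le
  have hsy : cs.geomRep (cs.simple i) y = y :=
    (cs.geomRep_simple_apply_eq_self_iff i y).mpr (le_antisymm hle (hy i hiI))
  have := ih _ (by rw [← hn]; exact hi) (mul_mem hw (cs.simple_mem_standardParabolic hiI))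
    (by rw [geomRep_mul_apply, hsy, hwy]) rfl
  rw [← cs.simple_mul_simple_cancel_right (w := w) i]
  exact mul_mem this (cs.simple_mem_standardParabolic ⟨hiI, hsy⟩)

theorem geomRep_eq_self_of_mem_standardParabolic {I : Set B} {y : B →₀ ℝ}
    (hy : ∀ i ∈ I, cs.geomRep (cs.simple i) y = y) {w : W} (hw : w ∈ cs.standardParabolic I) :
    cs.geomRep w y = y := by
  induction hw using Subgroup.closure_induction with
  | mem _ h => obtain ⟨i, hi, rfl⟩ := h; exact hy i hi
  | one => simp
  | mul v w _ _ hv hw => rw [geomRep_mul_apply, hw, hv]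
  | inv v _ hv => conv_lhs => rw [← hv, geomRep_inv_apply_apply]

theorem geomRep_conj_apply_eq_iff (g w : W) (x : B →₀ ℝ) :
    cs.geomRep (g⁻¹ * w * g) x = x ↔ cs.geomRep w (cs.geomRep g x) = cs.geomRep g x := by
  rw [geomRep_mul_apply, geomRep_mul_apply]
  constructor <;> intro h
  · conv_rhs => rw [← h, geomRep_apply_inv_apply]
  · rw [h, geomRep_inv_apply_apply]

theorem IsParabolicIn.le {cs : CoxeterSystem M W} {P Q : Subgroup W}
    (h : cs.IsParabolicIn P Q) : Q ≤ P := by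
  obtain ⟨g, I, rfl, p, hp, J, hJ, rfl⟩ := h
  intro w hw
  rw [mem_conjParabolic] at hw
  have : p⁻¹ * w * p ∈ cs.conjParabolic g I := by
    rw [mem_conjParabolic]
    convert cs.standardParabolic_mono hJ hw using 1
    group
  rwa [Subgroup.mul_mem_cancel_right _ hp, Subgroup.mul_mem_cancel_left _ (inv_mem hp)] at this

variable [Finite W]

/-- The stabilizer of a point in a parabolic subgroup `P` is parabolic in `P`. -/
theorem exists_conjParabolic_eq_stabilizer (g : W) (I : Set B) (x : B →₀ ℝ) :
    ∃ p ∈ cs.conjParabolic g I, ∃ K ⊆ I, ∀ w,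
      w ∈ cs.conjParabolic (p * g) K ↔ w ∈ cs.conjParabolic g I ∧ cs.geomRep w x = x := by
  obtain ⟨p, hp, hdom⟩ := cs.exists_geomCoroot_nonneg I (cs.geomRep g⁻¹ x)
  set y := cs.geomRep p (cs.geomRep g⁻¹ x) with hy
  have hyx : cs.geomRep (g * p⁻¹) y = x := by
    rw [geomRep_mul_apply, hy, geomRep_inv_apply_apply, geomRep_apply_inv_apply]
  have hdom' : ∀ i ∈ I, 0 ≤ cs.invForm y (Finsupp.single i 1) := fun i hi => by
    have h₁ := cs.two_mul_invForm_single i y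
    have h₂ := mul_nonneg (hdom i hi) (cs.invForm_single_self_pos i).le
    linarith
  -- The stabilizer of the dominant point `y` in `W_I` is standard; conjugating by `g p⁻¹`, which
  -- sends `y` to `x`, gives the stabilizer of `x`.
  refine ⟨g * p⁻¹ * g⁻¹, ?_, {i ∈ I | cs.geomRep (cs.simple i) y = y}, fun i hi => hi.1,
    fun w => ?_⟩
  · rw [mem_conjParabolic]
    simpa [mul_assoc] using hp
  have hmem : w ∈ cs.conjParabolic g I ↔
      (g * p⁻¹)⁻¹ * w * (g * p⁻¹) ∈ cs.standardParabolic I := by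
    rw [mem_conjParabolic,
      show (g * p⁻¹)⁻¹ * w * (g * p⁻¹) = p * (g⁻¹ * w * g) * p⁻¹ by group,
      Subgroup.mul_mem_cancel_right _ (inv_mem hp), Subgroup.mul_mem_cancel_left _ hp]
  rw [inv_mul_cancel_right, mem_conjParabolic, hmem, ← hyx, ← geomRep_conj_apply_eq_iff]
  constructor
  · intro h
    exact ⟨cs.standardParabolic_mono (fun i hi => hi.1) h,
      cs.geomRep_eq_self_of_mem_standardParabolic (fun i hi => hi.2) h⟩
  · rintro ⟨h₁, h₂⟩
    exact cs.mem_standardParabolic_of_geomRep_eq_self hdom' h₁ h₂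

/-- Every parabolic subgroup is the stabilizer of a point. -/
theorem IsParabolic.exists_eq_stabilizer {cs : CoxeterSystem M W} {P : Subgroup W}
    (hP : cs.IsParabolic P) : ∃ x, ∀ w, w ∈ P ↔ cs.geomRep w x = x := by
  classical
  obtain ⟨g, I, rfl⟩ := hP
  -- A dominant point lying on exactly the walls indexed by `I`.
  obtain ⟨y, hy⟩ := cs.exists_invForm_single_eq fun b => if b ∈ I then 0 else 1
  have hI : {i ∈ Set.univ | cs.geomRep (cs.simple i) y = y} = I := by
    ext i
    simp [geomRep_simple_apply_eq_self_iff, hy]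
  refine ⟨cs.geomRep g y, fun w => ?_⟩
  rw [mem_conjParabolic, ← geomRep_conj_apply_eq_iff]
  constructor
  · exact cs.geomRep_eq_self_of_mem_standardParabolic fun i hi => (hI.symm ▸ hi : i ∈ {i ∈ _ | _}).2
  · intro h
    rw [← hI]
    refine cs.mem_standardParabolic_of_geomRep_eq_self (fun i _ => ?_) ?_ h
    · rw [hy]; split_ifs <;> norm_num
    · rw [standardParabolic_univ]; trivial

theorem isParabolicIn_of_le {P Q : Subgroup W} (hP : cs.IsParabolic P) (hQ : cs.IsParabolic Q)
    (h : Q ≤ P) : cs.IsParabolicIn P Q := by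
  obtain ⟨x, hx⟩ := hQ.exists_eq_stabilizer
  obtain ⟨g, I, rfl⟩ := hP
  obtain ⟨p, hp, K, hK, hpK⟩ := cs.exists_conjParabolic_eq_stabilizer g I x
  refine ⟨g, I, rfl, p, hp, K, hK, ?_⟩
  ext w
  rw [hpK, ← hx]
  exact ⟨fun hw => ⟨h hw, hw⟩, And.right⟩

/-- Let `P` be a minimal parabolic containing `w`. If `w` fixes `x`, the stabilizer of `x` in `P` is
again a parabolic containing `w`, so it is all of `P`. Any other parabolic containing `w` is the
stabilizer of a point of `Fix w`, so it contains `P`. -/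
theorem isParabolic_parabolicClosure_and_mem_iff (w : W) :
    cs.IsParabolic (cs.parabolicClosure w) ∧ ∀ v, v ∈ cs.parabolicClosure w ↔
      ∀ x, cs.geomRep w x = x → cs.geomRep v x = x := by
  have hne : {P | cs.IsParabolic P ∧ w ∈ P}.Nonempty := by
    refine ⟨cs.conjParabolic 1 Set.univ, ⟨1, _, rfl⟩, ?_⟩
    rw [mem_conjParabolic, standardParabolic_univ]
    trivial
  obtain ⟨P, hmin⟩ := (Set.toFinite {P | cs.IsParabolic P ∧ w ∈ P}).exists_minimal hne
  obtain ⟨hPpar, hwP⟩ := hmin.prop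
  have hfix : ∀ v ∈ P, ∀ x, cs.geomRep w x = x → cs.geomRep v x = x := by
    intro v hv x hx
    obtain ⟨g, I, rfl⟩ := hPpar
    obtain ⟨p, -, K, -, hpK⟩ := cs.exists_conjParabolic_eq_stabilizer g I x
    have hle := hmin.le_of_le (y := cs.conjParabolic (p * g) K)
      ⟨⟨_, _, rfl⟩, (hpK w).mpr ⟨hwP, hx⟩⟩ fun v hv => ((hpK v).mp hv).1
    exact ((hpK v).mp (hle hv)).2
  have hle : P = cs.parabolicClosure w := by
    refine le_antisymm (le_sInf ?_) (sInf_le hmin.prop)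
    rintro Q ⟨hQ, hwQ⟩ v hv
    obtain ⟨x, hx⟩ := hQ.exists_eq_stabilizer
    exact (hx v).mpr (hfix v hv x ((hx w).mp hwQ))
  rw [← hle]
  refine ⟨hPpar, fun v => ⟨hfix v, fun hv => ?_⟩⟩
  obtain ⟨x, hx⟩ := hPpar.exists_eq_stabilizer
  exact (hx v).mpr (hv x ((hx w).mp hwP))

theorem isParabolic_parabolicClosure (w : W) : cs.IsParabolic (cs.parabolicClosure w) :=
  (cs.isParabolic_parabolicClosure_and_mem_iff w).1

theorem mem_parabolicClosure_iff {v w : W} : v ∈ cs.parabolicClosure w ↔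
    ∀ x, cs.geomRep w x = x → cs.geomRep v x = x :=
  (cs.isParabolic_parabolicClosure_and_mem_iff w).2 v

end CoxeterSystem

namespace CoxeterSystem

variable {B W : Type*} [Group W] {M : CoxeterMatrix B} (cs : CoxeterSystem M W)

/-! ### The moved space and Carter's formula for the reflection length -/

/-- The range of `w - 1` in the geometric representation. -/
noncomputable def movedSpace (w : W) : Submodule ℝ (B →₀ ℝ) :=
  LinearMap.range (cs.geomRep w - 1)

theorem geomRep_sub_mem_movedSpace (w : W) (x : B →₀ ℝ) :
    cs.geomRep w x - x ∈ cs.movedSpace w :=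
  ⟨x, rfl⟩

theorem movedSpace_one : cs.movedSpace 1 = ⊥ := by
  rw [eq_bot_iff]
  rintro _ ⟨x, rfl⟩
  simp

theorem movedSpace_mul_le (v w : W) :
    cs.movedSpace (v * w) ≤ cs.movedSpace v ⊔ cs.movedSpace w := by
  rintro _ ⟨x, rfl⟩
  have : (cs.geomRep (v * w) - 1) x =
      (cs.geomRep v (cs.geomRep w x) - cs.geomRep w x) + (cs.geomRep w x - x) := by
    rw [LinearMap.sub_apply, geomRep_mul_apply, Module.End.one_apply, sub_add_sub_cancel]
  rw [this]
  exact Submodule.add_mem_sup (cs.geomRep_sub_mem_movedSpace v _)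
    (cs.geomRep_sub_mem_movedSpace w x)

theorem IsReflection.reflectionLength_le_one {cs : CoxeterSystem M W} {t : W}
    (ht : cs.IsReflection t) : cs.reflectionLength t ≤ 1 :=
  Nat.sInf_le ⟨[t], by simpa using ht, by simp, rfl⟩

theorem inv_eq_self_of_sq_eq_one {u : W} (hu : u ^ 2 = 1) : u⁻¹ = u :=
  inv_eq_of_mul_eq_one_right (by rw [← sq, hu])

theorem geomRep_apply_apply_of_sq_eq_one {u : W} (hu : u ^ 2 = 1) (x : B →₀ ℝ) :
    cs.geomRep u (cs.geomRep u x) = x := by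
  rw [← geomRep_mul_apply, ← sq, hu, map_one, Module.End.one_apply]

theorem geomRep_eq_neg_of_mem_movedSpace {u : W} (hu : u ^ 2 = 1) {x : B →₀ ℝ}
    (hx : x ∈ cs.movedSpace u) : cs.geomRep u x = -x := by
  obtain ⟨y, rfl⟩ := hx
  rw [LinearMap.sub_apply, Module.End.one_apply, map_sub,
    cs.geomRep_apply_apply_of_sq_eq_one hu, neg_sub]

variable [Finite W]

/-- A vector orthogonal to the fixed space of `w` lies in the moved space of `w`. -/
theorem mem_movedSpace_of_forall_invForm_eq_zero {w : W} {z : B →₀ ℝ}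
    (hz : ∀ x, cs.geomRep w x = x → cs.invForm x z = 0) : z ∈ cs.movedSpace w := by
  have := cs.finite_index
  rw [← LinearMap.BilinForm.orthogonal_orthogonal cs.invForm_nondegenerate cs.invForm_isRefl
    (cs.movedSpace w)]
  intro x hx
  refine hz x (sub_eq_zero.mp (cs.eq_zero_of_invForm_self ?_))
  -- Invariance gives `⟨y, wx⟩ = ⟨w⁻¹y, x⟩`, and `x ⊥ Mov w` gives `⟨w⁻¹y, x⟩ = ⟨y, x⟩`; hence `⟨y,
  -- y⟩ = 0`.
  set y := cs.geomRep w x - x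
  have h : cs.invForm (cs.geomRep w (cs.geomRep w⁻¹ y) - cs.geomRep w⁻¹ y) x = 0 :=
    hx _ (cs.geomRep_sub_mem_movedSpace w _)
  have h' := cs.invForm_geomRep w (cs.geomRep w⁻¹ y) x
  rw [geomRep_apply_inv_apply] at h h'
  rw [map_sub, LinearMap.sub_apply, ← h', sub_eq_zero] at h
  rw [map_sub, h, sub_self]

theorem invForm_eq_zero_of_mem_movedSpace {w : W} {x z : B →₀ ℝ} (hx : cs.geomRep w x = x)
    (hz : z ∈ cs.movedSpace w) : cs.invForm x z = 0 := by
  obtain ⟨y, rfl⟩ := hz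
  rw [LinearMap.sub_apply, Module.End.one_apply, map_sub, sub_eq_zero]
  conv_lhs => rw [← hx, invForm_geomRep]

theorem IsReflection.exists_root {cs : CoxeterSystem M W} {t : W} (ht : cs.IsReflection t) :
    ∃ (β : B →₀ ℝ) (f : (B →₀ ℝ) → ℝ), β ≠ 0 ∧ ∀ x, cs.geomRep t x = x - f x • β ∧
      2 * cs.invForm x β = f x * cs.invForm β β := by
  obtain ⟨g, i, rfl⟩ := ht
  refine ⟨cs.geomRep g (Finsupp.single i 1), fun x => M.geomCoroot i (cs.geomRep g⁻¹ x), ?_,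
    fun x => ⟨?_, ?_⟩⟩
  · intro h
    have := cs.geomRep_inv_apply_apply g (Finsupp.single i 1)
    rw [h, map_zero] at this
    exact Finsupp.single_ne_zero.mpr one_ne_zero this.symm
  · rw [geomRep_mul_apply, geomRep_mul_apply, geomRep_simple_apply, map_sub, map_smul,
      geomRep_apply_inv_apply]
  · rw [invForm_geomRep, ← two_mul_invForm_single, ← cs.invForm_geomRep g (cs.geomRep g⁻¹ x),
      geomRep_apply_inv_apply]

theorem IsReflection.finrank_movedSpace_le {cs : CoxeterSystem M W} {t : W}
    (ht : cs.IsReflection t) : Module.finrank ℝ (cs.movedSpace t) ≤ 1 := by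
  obtain ⟨β, f, hβ, h⟩ := ht.exists_root
  rw [← finrank_span_singleton (K := ℝ) hβ]
  refine Submodule.finrank_mono ?_
  rintro _ ⟨x, rfl⟩
  rw [LinearMap.sub_apply, (h x).1, Module.End.one_apply, sub_sub_cancel_left]
  exact neg_mem (Submodule.smul_mem _ _ (Submodule.mem_span_singleton_self β))

theorem finrank_movedSpace_mul_le (v w : W) : Module.finrank ℝ (cs.movedSpace (v * w)) ≤
    Module.finrank ℝ (cs.movedSpace v) + Module.finrank ℝ (cs.movedSpace w) := by
  have := cs.finite_index
  exact (Submodule.finrank_mono (cs.movedSpace_mul_le v w)).trans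
    (Submodule.finrank_add_le_finrank_add_finrank _ _)

theorem finrank_movedSpace_le_reflectionLength (w : W) :
    Module.finrank ℝ (cs.movedSpace w) ≤ cs.reflectionLength w := by
  obtain ⟨l, hl, rfl, hlen⟩ := cs.exists_reflectionWord w
  rw [← hlen]
  clear hlen
  induction l with
  | nil => rw [List.prod_nil, movedSpace_one, finrank_bot]; exact Nat.zero_le _
  | cons t l ih =>
    rw [List.prod_cons, List.length_cons]
    have h₁ := cs.finrank_movedSpace_mul_le t l.prod
    have h₂ := (hl t (by simp)).finrank_movedSpace_le
    have h₃ := ih fun s hs => hl s (by simp [hs])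
    omega

theorem exists_isReflection_mem_parabolicClosure {w : W} (hw : w ≠ 1) :
    ∃ t ∈ cs.parabolicClosure w, cs.IsReflection t := by
  have hmem : w ∈ cs.parabolicClosure w := cs.mem_parabolicClosure_iff.mpr fun _ => id
  obtain ⟨g, I, hI⟩ := cs.isParabolic_parabolicClosure w
  rw [hI] at hmem ⊢
  rcases I.eq_empty_or_nonempty with rfl | ⟨i, hi⟩
  · rw [mem_conjParabolic, standardParabolic, Set.image_empty, Subgroup.closure_empty,
      Subgroup.mem_bot] at hmem
    refine absurd ?_ hw
    simpa [mul_assoc, inv_mul_eq_one, eq_comm] using hmem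
  · refine ⟨g * cs.simple i * g⁻¹, ?_, g, i, rfl⟩
    rw [mem_conjParabolic]
    simpa [mul_assoc] using cs.simple_mem_standardParabolic hi

theorem finrank_movedSpace_lt_of_ker_lt {v w : W} (h : ∀ x, cs.geomRep w x = x → cs.geomRep v x = x)
    {x : B →₀ ℝ} (hvx : cs.geomRep v x = x) (hwx : cs.geomRep w x ≠ x) :
    Module.finrank ℝ (cs.movedSpace v) < Module.finrank ℝ (cs.movedSpace w) := by
  have := cs.finite_index
  have h₁ := LinearMap.finrank_range_add_finrank_ker (cs.geomRep v - 1)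
  have h₂ := LinearMap.finrank_range_add_finrank_ker (cs.geomRep w - 1)
  have h₃ : LinearMap.ker (cs.geomRep w - 1) < LinearMap.ker (cs.geomRep v - 1) := by
    refine lt_of_le_of_ne (fun y hy => ?_) fun heq => hwx ?_
    · exact sub_eq_zero.mpr (h y (sub_eq_zero.mp hy))
    · have : x ∈ LinearMap.ker (cs.geomRep v - 1) := sub_eq_zero.mpr hvx
      rw [← heq] at this
      exact sub_eq_zero.mp this
  have h₄ := Submodule.finrank_lt_finrank_of_lt h₃
  rw [movedSpace, movedSpace]
  omega

/-- Every `w ≠ 1` can be multiplied by a reflection that lowers the dimension of the moved space. -/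
theorem exists_isReflection_finrank_movedSpace_lt {w : W} (hw : w ≠ 1) :
    ∃ t, cs.IsReflection t ∧
      Module.finrank ℝ (cs.movedSpace (t * w)) < Module.finrank ℝ (cs.movedSpace w) := by
  obtain ⟨t, htP, ht⟩ := cs.exists_isReflection_mem_parabolicClosure hw
  rw [mem_parabolicClosure_iff] at htP
  obtain ⟨β, f, hβ, hf⟩ := ht.exists_root
  have hββ := (cs.invForm_self_pos hβ).ne'
  -- As `t ∈ P(w)` fixes `Fix w`, its root `β` is orthogonal to `Fix w`, hence `β = wx - x` for some
  -- `x`.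
  obtain ⟨x, hx⟩ := cs.mem_movedSpace_of_forall_invForm_eq_zero (w := w) (z := β) fun x hx => by
    have h := htP x hx
    rw [(hf x).1, sub_eq_self, smul_eq_zero, or_iff_left hβ] at h
    have h' := (hf x).2
    rw [h] at h'
    linarith
  rw [LinearMap.sub_apply, Module.End.one_apply] at hx
  -- Since `wx` and `x` have equal norm, `t` swaps them: `tw` fixes `x` in addition to `Fix w`.
  have hfx : f (cs.geomRep w x) = 1 := by
    have h := (hf (cs.geomRep w x)).2
    refine mul_right_cancel₀ hββ ?_
    rw [← h, one_mul, ← hx]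
    simp only [map_sub, LinearMap.sub_apply, invForm_geomRep, cs.invForm_comm x (cs.geomRep w x)]
    ring
  refine ⟨t, ht, cs.finrank_movedSpace_lt_of_ker_lt (x := x) (fun y hy => ?_) ?_ fun h => hβ ?_⟩
  · rw [geomRep_mul_apply, hy, htP y hy]
  · rw [geomRep_mul_apply, (hf _).1, hfx, one_smul, ← hx, sub_sub_cancel]
  · rw [← hx, h, sub_self]

theorem reflectionLength_le_finrank_movedSpace (w : W) :
    cs.reflectionLength w ≤ Module.finrank ℝ (cs.movedSpace w) := by
  induction hn : Module.finrank ℝ (cs.movedSpace w) using Nat.strong_induction_on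
    generalizing w with
  | _ n ih =>
  rcases eq_or_ne w 1 with rfl | hw
  · rw [reflectionLength_one]; exact Nat.zero_le _
  obtain ⟨t, ht, hlt⟩ := cs.exists_isReflection_finrank_movedSpace_lt hw
  have h₁ := ih _ (hn ▸ hlt) (t * w) rfl
  have h₂ := cs.reflectionLength_mul_le t (t * w)
  rw [← mul_assoc, ht.mul_self, one_mul] at h₂
  have h₃ := ht.reflectionLength_le_one
  omega

/-- Carter's formula: the reflection length is the dimension of the moved space. -/
theorem reflectionLength_eq_finrank_movedSpace (w : W) :
    cs.reflectionLength w = Module.finrank ℝ (cs.movedSpace w) :=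
  le_antisymm (cs.reflectionLength_le_finrank_movedSpace w)
    (cs.finrank_movedSpace_le_reflectionLength w)

/-! ### Involutions -/

theorem mem_parabolicClosure_iff_movedSpace_le {v w : W} :
    v ∈ cs.parabolicClosure w ↔ cs.movedSpace v ≤ cs.movedSpace w := by
  rw [mem_parabolicClosure_iff]
  constructor
  · intro h z hz
    exact cs.mem_movedSpace_of_forall_invForm_eq_zero fun x hx =>
      cs.invForm_eq_zero_of_mem_movedSpace (h x hx) hz
  · intro h x hx
    refine sub_eq_zero.mp (cs.eq_zero_of_invForm_self ?_)
    have hmem := cs.geomRep_sub_mem_movedSpace v x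
    have h₁ := cs.invForm_eq_zero_of_mem_movedSpace hx (h hmem)
    have h₂ := cs.invForm_geomRep v x x
    rw [cs.invForm_comm, map_sub, LinearMap.sub_apply, sub_eq_zero] at h₁
    simp only [map_sub, LinearMap.sub_apply, h₂, cs.invForm_comm x (cs.geomRep v x), h₁, sub_self]

/-- If `u` is an involution and `v ∈ P(u)`, then `v u = u + 1 - v = u v` as operators. -/
theorem geomRep_mul_of_mem_parabolicClosure {u v : W} (hu : u ^ 2 = 1)
    (hv : v ∈ cs.parabolicClosure u) (x : B →₀ ℝ) :
    cs.geomRep v (cs.geomRep u x) = cs.geomRep u x + x - cs.geomRep v x ∧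
    cs.geomRep u (cs.geomRep v x) = cs.geomRep u x + x - cs.geomRep v x := by
  constructor
  · have h := cs.mem_parabolicClosure_iff.mp hv (cs.geomRep u x + x)
      (by rw [map_add, cs.geomRep_apply_apply_of_sq_eq_one hu, add_comm])
    rw [map_add] at h
    exact eq_sub_of_add_eq h
  · have h := cs.geomRep_eq_neg_of_mem_movedSpace hu
      (cs.mem_parabolicClosure_iff_movedSpace_le.mp hv (cs.geomRep_sub_mem_movedSpace v x))
    rw [map_sub, sub_eq_iff_eq_add] at h
    rw [h]
    abel

theorem absLE_of_mem_parabolicClosure {u v : W} (hu : u ^ 2 = 1) (hv2 : v ^ 2 = 1)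
    (hv : v ∈ cs.parabolicClosure u) : cs.AbsLE v u := by
  have := cs.finite_index
  have hge := cs.reflectionLength_mul_le v (v⁻¹ * u)
  rw [mul_inv_cancel_left] at hge
  refine le_antisymm ?_ hge
  simp only [reflectionLength_eq_finrank_movedSpace, inv_eq_self_of_sq_eq_one hv2]
  -- A vector `vuy - y = uy - vy` of the intersection is negated by `v`, being in `Mov v`, and fixed
  -- by `v`, by the formula for `vu`.
  have hdis : cs.movedSpace v ⊓ cs.movedSpace (v * u) = ⊥ := by
    rw [eq_bot_iff]
    rintro x ⟨hx, y, rfl⟩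
    have h := cs.geomRep_eq_neg_of_mem_movedSpace hv2 hx
    rw [LinearMap.sub_apply, Module.End.one_apply, geomRep_mul_apply] at h ⊢
    rw [map_sub, cs.geomRep_apply_apply_of_sq_eq_one hv2,
      (cs.geomRep_mul_of_mem_parabolicClosure hu hv y).1] at h
    rw [Submodule.mem_bot, (cs.geomRep_mul_of_mem_parabolicClosure hu hv y).1]
    refine self_eq_neg.mp (Eq.trans ?_ (h.trans ?_))
    · abel
    · abel
  have hsum := Submodule.finrank_sup_add_finrank_inf_eq (cs.movedSpace v) (cs.movedSpace (v * u))
  rw [hdis, finrank_bot, add_zero] at hsum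
  rw [← hsum]
  have hvle := cs.mem_parabolicClosure_iff_movedSpace_le.mp hv
  refine Submodule.finrank_mono (sup_le hvle ?_)
  exact (cs.movedSpace_mul_le v u).trans (sup_le hvle le_rfl)

theorem mem_parabolicClosure_and_sq_eq_one_of_absLE {u v : W} (hu : u ^ 2 = 1)
    (h : cs.AbsLE v u) : v ∈ cs.parabolicClosure u ∧ v ^ 2 = 1 := by
  have := cs.finite_index
  rw [AbsLE] at h
  simp only [reflectionLength_eq_finrank_movedSpace] at h
  have hle : cs.movedSpace u ≤ cs.movedSpace v ⊔ cs.movedSpace (v⁻¹ * u) := by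
    simpa using cs.movedSpace_mul_le v (v⁻¹ * u)
  have hsum := Submodule.finrank_sup_add_finrank_inf_eq (cs.movedSpace v)
    (cs.movedSpace (v⁻¹ * u))
  have hmono := Submodule.finrank_mono hle
  have heq : cs.movedSpace u = cs.movedSpace v ⊔ cs.movedSpace (v⁻¹ * u) :=
    Submodule.eq_of_le_of_finrank_le hle (by omega)
  have hdis : cs.movedSpace v ⊓ cs.movedSpace (v⁻¹ * u) = ⊥ :=
    Submodule.finrank_eq_zero.mp (by omega)
  have hv : v ∈ cs.parabolicClosure u :=
    cs.mem_parabolicClosure_iff_movedSpace_le.mpr (heq ▸ le_sup_left)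
  refine ⟨hv, cs.eq_one_of_geomRep_eq_one (LinearMap.ext fun x => ?_)⟩
  have hvle := cs.mem_parabolicClosure_iff_movedSpace_le.mp hv
  -- The vector `x - v²x = -p - vp` lies in both summands: it is visibly in `Mov v`, and since `u`
  -- negates `vp ∈ Mov u` it equals `(v⁻¹u - 1)(vp)`. So it is zero, and faithfulness gives `v² =
  -- 1`.
  set p := cs.geomRep v x - x with hp
  have hbp : cs.geomRep v p ∈ cs.movedSpace u := by
    refine hvle ⟨cs.geomRep v x, ?_⟩
    rw [LinearMap.sub_apply, Module.End.one_apply, hp, map_sub]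
  have h₁ : -p - cs.geomRep v p ∈ cs.movedSpace (v⁻¹ * u) := by
    refine ⟨cs.geomRep v p, ?_⟩
    rw [LinearMap.sub_apply, Module.End.one_apply, geomRep_mul_apply,
      cs.geomRep_eq_neg_of_mem_movedSpace hu hbp, map_neg, geomRep_inv_apply_apply]
  have hx : -p - cs.geomRep v p = x - cs.geomRep v (cs.geomRep v x) := by
    rw [hp, map_sub]; abel
  have h₂ : -p - cs.geomRep v p ∈ cs.movedSpace v := by
    refine ⟨-(cs.geomRep v x + x), ?_⟩
    rw [LinearMap.sub_apply, Module.End.one_apply, hx, map_neg, map_add]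
    abel
  have h₀ : -p - cs.geomRep v p ∈ (⊥ : Submodule ℝ (B →₀ ℝ)) := hdis ▸ ⟨h₂, h₁⟩
  rw [hx, Submodule.mem_bot, sub_eq_zero] at h₀
  rw [sq, geomRep_mul_apply, ← h₀, Module.End.one_apply]

theorem absLE_iff_of_sq_eq_one {u v : W} (hu : u ^ 2 = 1) :
    cs.AbsLE v u ↔ v ^ 2 = 1 ∧ v ∈ cs.parabolicClosure u :=
  ⟨fun h => (cs.mem_parabolicClosure_and_sq_eq_one_of_absLE hu h).symm,
    fun h => cs.absLE_of_mem_parabolicClosure hu h.1 h.2⟩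

theorem parabolicClosure_le_iff {v w : W} :
    cs.parabolicClosure v ≤ cs.parabolicClosure w ↔ v ∈ cs.parabolicClosure w := by
  refine ⟨fun h => h (cs.mem_parabolicClosure_iff.mpr fun _ => id), fun h x hx => ?_⟩
  rw [mem_parabolicClosure_iff_movedSpace_le] at *
  exact hx.trans h

theorem absInterval_eq_of_sq_eq_one {u : W} (hu : u ^ 2 = 1) :
    cs.absInterval u = {v : W | v ^ 2 = 1 ∧ v ∈ cs.parabolicClosure u} := by
  ext v
  have h1 : cs.AbsLE 1 v := by simp [AbsLE, reflectionLength_one]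
  exact (and_iff_right h1).trans (cs.absLE_iff_of_sq_eq_one hu)

theorem involutiveParabolicsOf_eq (u : W) : cs.involutiveParabolicsOf u =
    {Q : Subgroup W | cs.IsInvolutiveParabolic Q ∧ Q ≤ cs.parabolicClosure u} := by
  ext Q
  exact ⟨fun h => ⟨h.2, h.1.le⟩, fun h =>
    ⟨cs.isParabolicIn_of_le (cs.isParabolic_parabolicClosure u) h.1.1 h.2, h.1⟩⟩

end CoxeterSystem

theorem mainTheorem4 {B W : Type*} [Group W] [Finite W] {M : CoxeterMatrix B}
    (cs : CoxeterSystem M W) (u : W) (hu : u ^ 2 = 1) :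
    cs.absInterval u = {v : W | v ^ 2 = 1 ∧ v ∈ cs.parabolicClosure u} ∧
    cs.involutiveParabolicsOf u =
      {Q : Subgroup W | cs.IsInvolutiveParabolic Q ∧ Q ≤ cs.parabolicClosure u} ∧
    ∃ φ : cs.AbsInterval u ≃o cs.involutiveParabolicsOf u,
      ∀ v : cs.AbsInterval u, (φ v : Subgroup W) = cs.parabolicClosure v.1 := by
  have hint := cs.absInterval_eq_of_sq_eq_one hu
  have hinv := cs.involutiveParabolicsOf_eq u
  refine ⟨hint, hinv, ?_⟩
  have hmem (v : cs.AbsInterval u) : v.1 ^ 2 = 1 ∧ v.1 ∈ cs.parabolicClosure u :=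
    hint.subset v.2
  let f : cs.AbsInterval u → cs.involutiveParabolicsOf u := fun v =>
    ⟨cs.parabolicClosure v.1, hinv.superset
      ⟨⟨cs.isParabolic_parabolicClosure v.1, v.1, (hmem v).1, rfl⟩,
        cs.parabolicClosure_le_iff.mpr (hmem v).2⟩⟩
  -- The criterion is applied below `w`, itself an involution, rather than below `u`.
  have hf : ∀ v w, f v ≤ f w ↔ v ≤ w := fun v w =>
    cs.parabolicClosure_le_iff.trans
      ((and_iff_right (hmem v).1).symm.trans (cs.absLE_iff_of_sq_eq_one (hmem w).1).symm)
  have hsurj : Function.Surjective f := by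
    rintro ⟨Q, hQ⟩
    obtain ⟨⟨-, x, hx, rfl⟩, hle⟩ := hinv.subset hQ
    exact ⟨⟨x, hint.superset ⟨hx, cs.parabolicClosure_le_iff.mp hle⟩⟩, rfl⟩
  exact ⟨RelIso.ofSurjective (OrderEmbedding.ofMapLEIff f hf) hsurj, fun v => rfl⟩
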